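/- Stochastic block model. Let $Q\in\mathbb N$, let $\pi^*=(\pi^*_{q,l})\in[0,1]^{Q\times Q}$, and let $\alpha^*=(\alpha^*_1,\dots,\alpha^*_Q)$ be a probability vector. The labels $Z=(Z_i)_{i\ge1}$ are i.i.d. with $\mathbb P(Z_i=q)=\alpha^*_q$. Given $Z=z$, the entries of the random adjacency matrix $X=(X_{i,j})_{i,j\ge1}$ are independent, with $X_{i,i}=0$ and, for $i\neq j$, $X_{i,j}\sim\mathcal B(\pi^*_{z_i,z_j})$. Denote by $\mathbb P$ the joint law of $(Z,X)$ and by $P^*=\mathbb P(\cdot\mid Z=z^*)$ the conditional law of $X$ given the whole label sequence $z^*\in\{1,\dots,Q\}^{\mathbb N^*}$. Write $X_{[n]}=(X_{i,j})_{1\le i,j\le n}$, $Z_{[n]}=(Z_1,\dots,Z_n)$, $z^*_{[n]}=(z^*_1,\dots,z^*_n)$. Two label vectors $z,z'\in\{1,\dots,Q\}^n$ are equivalent if there is a permutation $\sigma$ of $\{1,\dots,Q\}$ with $\pi^*_{\sigma(q),\sigma(l)}=\pi^*_{q,l}$ for all $q,l$ and $z'_i=\sigma(z_i)$ for all $i\le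 n$; $[z]$ denotes the equivalence class of $z$. Fix $0<\gamma<1/Q$ and consider the assumptions * (A1) for all $q\ne q'$ there is $l$ with $\pi^*_{q,l}\ne\pi^*_{q',l}$ or $\pi^*_{l,q}\neq\pi^*_{l,q'}$; * (A2) there is $\zeta>0$ such that, for all $q,l$, $\pi^*_{q,l}\in(0,1)$ implies $\pi^*_{q,l}\in[\zeta,1-\zeta]$; * (A3) $\alpha^*_q\in[\gamma,1-\gamma]$ for all $q$; * (A4) with $n_0\ge1$: $|\{1\le i\le n: z^*_i=q\}|/n\ge\gamma$ for all $q$ and all $n\ge n_0$. **Theorem.** Assume that $\pi^*$ satisfies (A1) and (A2). There is a constant $\kappa>0$, depending only on $\pi^*$ (hence $Q$) and $\gamma$, such that for every $\alpha^*$ satisfying (A3) and every $t>0$ the following hold. 1. There is a constant $C$, not depending on $z^*$, $n_0$ or $n$, such that for every $n_0\ge 1$, every $z^*$ satisfying (A4) with $n_0$, and every $n\ge n_0$, $$P^*\Bigg[\sum_{[z]\ne[z^*_{[n]}]}\frac{\mathbb P([Z_{[n]}]=[z]\mid X_{[n]})}{\mathbb P([Z_{[n]}]=[z^*_{[n]}]\mid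 X_{[n]})}>t\Bigg]\le C\,n\,e^{-\kappa n},$$ the sum being over the equivalence classes of label vectors of length $n$ other than $[z^*_{[n]}]$. 2. There is a constant $C$, not depending on $n$, such that for every $n$, $$\mathbb P\Bigg[\sum_{[z]\ne[Z_{[n]}]}\frac{\mathbb P([Z_{[n]}]=[z]\mid X_{[n]})}{\mathbb P([Z_{[n]}]=c\mid X_{[n]})\big|_{c=[Z_{[n]}]}}>t\Bigg]\le C\,n\,e^{-\kappa n},$$ i.e. the same holds under $\mathbb P$, with the random true labels $Z_{[n]}$ in place of $z^*_{[n]}$ and without (A4). -/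

import Mathlib

open MeasureTheory ProbabilityTheory
open scoped ENNReal

namespace SBM

/-- Connection probabilities of a stochastic block model with `Q` classes: `π q l` is the
probability of an edge from a vertex of class `q` to a (different) vertex of class `l`. -/
abbrev EdgeParam (Q : ℕ) : Type := Fin Q → Fin Q → unitInterval

/-- Infinite label sequences. Vertices are indexed by `ℕ = {0, 1, 2, …}`, so the first `n`
vertices are `0, …, n - 1`. -/
abbrev LabelSeq (Q : ℕ) : Type := ℕ → Fin Q

/-- Infinite adjacency matrices; `true` at `(i, j)` means that there is an edge from `i` to `j`. -/
abbrev AdjMatrix : Type := ℕ × ℕ → Bool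

/-- Law of the labels: i.i.d. with distribution `α` on the classes. -/
noncomputable def labelLaw {Q : ℕ} (α : PMF (Fin Q)) : Measure (LabelSeq Q) :=
  Measure.infinitePi fun _ : ℕ => α.toMeasure

/-- Law of the single entry `X i j` given the labels: no loops, and Bernoulli with parameter
`π (z i) (z j)` off the diagonal. -/
noncomputable def entryLaw {Q : ℕ} (π : EdgeParam Q) (z : LabelSeq Q) (p : ℕ × ℕ) :
    Measure Bool :=
  if p.1 = p.2 then Measure.dirac false else bernoulliMeasure true false (π (z p.1) (z p.2))

instance instIsProbabilityMeasureEntryLaw {Q : ℕ} (π : EdgeParam Q) (z : LabelSeq Q)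
    (p : ℕ × ℕ) : IsProbabilityMeasure (entryLaw π z p) := by
  unfold entryLaw
  split_ifs <;> infer_instance

/-- The conditional law `P*` of the adjacency matrix given that the whole label sequence is `z`:
the entries are independent. -/
noncomputable def edgeLaw {Q : ℕ} (π : EdgeParam Q) (z : LabelSeq Q) : Measure AdjMatrix :=
  Measure.infinitePi (entryLaw π z)

instance instIsProbabilityMeasureEdgeLaw {Q : ℕ} (π : EdgeParam Q) (z : LabelSeq Q) :
    IsProbabilityMeasure (edgeLaw π z) := by
  unfold edgeLaw
  infer_instance

theorem measurable_edgeLaw {Q : ℕ} (π : EdgeParam Q) :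
    Measurable (fun z : LabelSeq Q => edgeLaw π z) := by
  refine Measurable.measure_of_isPiSystem_of_isProbabilityMeasure
    (S := squareCylinders fun _ : ℕ × ℕ => {s : Set Bool | MeasurableSet s})
    generateFrom_squareCylinders.symm
    (isPiSystem_squareCylinders (fun _ => MeasurableSpace.isPiSystem_measurableSet) (by simp)) ?_
  rintro _ ⟨s, t, ht, rfl⟩
  have h : ∀ z : LabelSeq Q, edgeLaw π z ((s : Set (ℕ × ℕ)).pi t)
      = ∏ p ∈ s, entryLaw π z p (t p) := fun z =>
    Measure.infinitePi_pi _ fun p _ => ht p (Set.mem_univ p)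
  simp only [h]
  refine Finset.measurable_prod _ fun p _ => ?_
  have h2 : (fun z : LabelSeq Q => entryLaw π z p (t p))
      = (fun w : Fin Q × Fin Q => (if p.1 = p.2 then Measure.dirac false
          else bernoulliMeasure true false (π w.1 w.2) : Measure Bool) (t p))
        ∘ fun z => (z p.1, z p.2) := rfl
  rw [h2]
  exact (measurable_of_countable _).comp
    ((measurable_pi_apply _).prodMk (measurable_pi_apply _))

/-- The conditional law of the adjacency matrix given the labels, as a Markov kernel. -/
noncomputable def edgeKernel {Q : ℕ} (π : EdgeParam Q) : Kernel (LabelSeq Q) AdjMatrix where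
  toFun := edgeLaw π
  measurable' := measurable_edgeLaw π

instance instIsMarkovKernelEdgeKernel {Q : ℕ} (π : EdgeParam Q) :
    IsMarkovKernel (edgeKernel π) :=
  ⟨fun z => instIsProbabilityMeasureEdgeLaw π z⟩

instance instIsProbabilityMeasureLabelLaw {Q : ℕ} (α : PMF (Fin Q)) :
    IsProbabilityMeasure (labelLaw α) := by
  unfold labelLaw
  infer_instance

/-- The stochastic block model: the joint law `P` of labels and adjacency matrix. -/
noncomputable def law {Q : ℕ} (α : PMF (Fin Q)) (π : EdgeParam Q) :
    Measure (LabelSeq Q × AdjMatrix) :=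
  labelLaw α ⊗ₘ edgeKernel π

instance instIsProbabilityMeasureLaw {Q : ℕ} (α : PMF (Fin Q)) (π : EdgeParam Q) :
    IsProbabilityMeasure (law α π) := by
  unfold law
  infer_instance

/-- The first `n` labels. -/
def labels {Q : ℕ} (n : ℕ) (z : LabelSeq Q) : Fin n → Fin Q := fun i => z i

/-- The adjacency matrix of the first `n` vertices. -/
def adj (n : ℕ) (x : AdjMatrix) : Fin n × Fin n → Bool := fun p => x (p.1, p.2)

/-- The permutations of the classes that leave the connection probabilities invariant. -/
def symmetries {Q : ℕ} (π : EdgeParam Q) : Set (Equiv.Perm (Fin Q)) :=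
  {σ | ∀ q l, π (σ q) (σ l) = π q l}

/-- Two label vectors are equivalent if one is the image of the other under a permutation of the
classes leaving `π` invariant. -/
def labelSetoid {Q : ℕ} (π : EdgeParam Q) (n : ℕ) : Setoid (Fin n → Fin Q) where
  r z z' := ∃ σ ∈ symmetries π, ∀ i, z' i = σ (z i)
  iseqv := by
    refine ⟨fun z => ⟨1, fun q l => rfl, fun i => rfl⟩, ?_, ?_⟩
    · rintro z z' ⟨σ, hσ, h⟩
      refine ⟨σ.symm, fun q l => ?_, fun i => by simp [h]⟩
      simpa using (hσ (σ.symm q) (σ.symm l)).symm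
    · rintro z z' z'' ⟨σ, hσ, h⟩ ⟨τ, hτ, h'⟩
      refine ⟨τ * σ, fun q l => ?_, fun i => by simp [h, h']⟩
      simp only [Equiv.Perm.mul_apply]
      rw [hτ, hσ]

/-- Equivalence classes of label vectors of length `n`. -/
abbrev LabelClass {Q : ℕ} (π : EdgeParam Q) (n : ℕ) : Type := Quotient (labelSetoid π n)

/-- The class of the first `n` labels of a label sequence. -/
def labelClass {Q : ℕ} (π : EdgeParam Q) (n : ℕ) (z : LabelSeq Q) : LabelClass π n :=
  Quotient.mk (labelSetoid π n) (labels n z)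

/-- The posterior probability that the class of the first `n` labels is `c`, given that the
adjacency matrix of the first `n` vertices is that of `x`. -/
noncomputable def posterior {Q : ℕ} (α : PMF (Fin Q)) (π : EdgeParam Q) (n : ℕ)
    (x : AdjMatrix) (c : LabelClass π n) : ℝ≥0∞ :=
  cond (law α π) {ω | adj n ω.2 = adj n x} {ω | labelClass π n ω.1 = c}

/-- The sum of the posterior ratios over all classes of label vectors of length `n` other than
the class of the first `n` labels of `z`. -/
noncomputable def posteriorRatioSum {Q : ℕ} (α : PMF (Fin Q)) (π : EdgeParam Q) (n : ℕ)
    (z : LabelSeq Q) (x : AdjMatrix) : ℝ≥0∞ :=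
  ∑' c : {c : LabelClass π n // c ≠ labelClass π n z},
    posterior α π n x c / posterior α π n x (labelClass π n z)

/-- No two classes have the same connection probabilities. -/
def Distinguishable {Q : ℕ} (π : EdgeParam Q) : Prop :=
  ∀ q q', q ≠ q' → ∃ l, π q l ≠ π q' l ∨ π l q ≠ π l q'

/-- The nondegenerate connection probabilities are bounded away from `0` and `1`. -/
def EdgeTruncated {Q : ℕ} (π : EdgeParam Q) : Prop :=
  ∃ ζ : ℝ, 0 < ζ ∧ ∀ q l, (π q l : ℝ) ∈ Set.Ioo 0 1 → (π q l : ℝ) ∈ Set.Icc ζ (1 - ζ)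

/-- The class proportions lie in `[γ, 1 - γ]`. -/
def ProportionsTruncated {Q : ℕ} (γ : ℝ) (α : PMF (Fin Q)) : Prop :=
  ∀ q, (α q).toReal ∈ Set.Icc γ (1 - γ)

/-- For `n ≥ n₀`, each class contains a fraction at least `γ` of
the first `n` vertices. -/
def FrequenciesTruncated {Q : ℕ} (γ : ℝ) (n₀ : ℕ) (z : LabelSeq Q) : Prop :=
  ∀ q, ∀ n, n₀ ≤ n → γ ≤ ((Finset.univ.filter fun i : Fin n => labels n z i = q).card : ℝ) / n

end SBM

/-! Every probability involved is a finite sum: the law of the first `n` labels and of the adjacency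
matrix of the first `n` vertices has the explicit mass `prior α v * likelihood π v y`
(`law_real_labels_adj_eq`), and the sum of the posterior ratios exceeds `t` only if the mass of the
label vectors that are not equivalent to the true vector `v` is at least `t` times the mass of those
that are (`mul_sameClassMass_le_otherClassMass`).

*Fixed true labels.* The event is handled by the Chernoff bound with exponent `1 / 2`. On it, the
square root of `t` times the likelihood of `v` is at most the sum over `u` not equivalent to `v` of
`√(likelihood u * likelihood v)`, weighted by `γ ^ (-d / 2)` with `d` the Hamming distance of `u`
to a well chosen symmetric image `σ ∘ v`; the weight accounts for the prior, which the symmetries of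
`π` need not preserve (`sqrt_mul_likelihood_le`). Summing over adjacency matrices turns the square
root into a Bhattacharyya affinity, a product over the entries that is at most `exp (-θ N)`, where
`N` counts the ordered pairs of vertices with different connection probabilities under `u` and `v`
(`sum_sqrt_likelihood_le`). Since `π` has finitely many values, `θ > 0`; this also covers
connection probabilities `0` and `1`.

The combinatorial core is `exists_symmetry_mul_hammingDist_le`: if each class is frequent under `v`,
then `N ≥ c n d` for some symmetry `σ`. Send each class to its most frequent label under `u`. If this
map preserves `π`, distinguishability makes it a permutation, hence a symmetry, and each vertex at
which `u` departs from it meets linearly many differing pairs. If it does not preserve `π`, two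
large blocks already give quadratically many differing pairs. The sum over `u` then becomes
`Q! * ((1 + Q a) ^ n - 1)` with `a` of order `exp (-κ n)`, which is of order `n * exp (-κ n)`.

*Random labels.* The frequency condition is only needed with `γ / 2` in place of `γ`, and it fails
with exponentially small probability (`sum_prior_infrequent_le`). -/

namespace SBM

variable {Q n : ℕ}

/-! ### Finite-dimensional laws -/

/-- The mass of an elementary cylinder with finitely many coordinates, indexed through an
embedding, under an infinite product measure. -/
theorem infinitePi_real_eval_eq {ι K X : Type*} [Fintype K] [MeasurableSpace X]
    [DiscreteMeasurableSpace X] (μ : ι → Measure X) [∀ i, IsProbabilityMeasure (μ i)]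
    (e : K ↪ ι) (y : K → X) :
    (Measure.infinitePi μ).real {x | ∀ k, x (e k) = y k} = ∏ k, (μ (e k)).real {y k} := by
  have hset : {x : ι → X | ∀ k, x (e k) = y k}
      = ((Finset.univ.map e : Finset ι) : Set ι).pi fun i => {a | ∀ k, e k = i → a = y k} := by
    ext x
    simp [Set.mem_pi]
  rw [hset, measureReal_def, Measure.infinitePi_pi _ fun i _ => .of_discrete, Finset.prod_map,
    ENNReal.toReal_prod]
  refine Finset.prod_congr rfl fun k _ => ?_
  rw [measureReal_def]
  congr 2
  ext a
  simp

/-- The probability of a set of values of a random variable with finitely many values, as the sum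
of the point masses. -/
theorem measureReal_mem_eq_sum {Ω F : Type*} [MeasurableSpace Ω] (μ : Measure Ω)
    [IsFiniteMeasure μ] [Fintype F] [MeasurableSpace F] [MeasurableSingletonClass F] {f : Ω → F}
    (hf : Measurable f) (S : Set F) [DecidablePred (· ∈ S)] :
    μ.real {x | f x ∈ S} = ∑ y, if y ∈ S then μ.real {x | f x = y} else 0 := by
  rw [← Finset.sum_filter, ← measureReal_biUnion_finset]
  · congr 1
    ext x
    simp
  · intro a _ b _ hab
    refine Set.disjoint_left.2 fun x hx hx' => hab ?_
    rw [← show f x = a from hx, ← show f x = b from hx']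
  · exact fun y _ => hf (measurableSet_singleton y)

/-- The mass that the law of an edge with connection probability `p` gives to `b`. -/
noncomputable def edgeMass (p : unitInterval) (b : Bool) : ℝ := if b then p else 1 - p

/-- The mass that the law of the entry at `p` gives to `b`, given the labels `v`. -/
noncomputable def entryMass (π : EdgeParam Q) (v : Fin n → Fin Q) (p : Fin n × Fin n)
    (b : Bool) : ℝ :=
  if p.1 = p.2 then (if b then 0 else 1) else edgeMass (π (v p.1) (v p.2)) b

/-- The conditional probability of the adjacency matrix `y` of the first `n` vertices, given that
their labels are `v`. -/
noncomputable def likelihood (π : EdgeParam Q) (v : Fin n → Fin Q)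
    (y : Fin n × Fin n → Bool) : ℝ :=
  ∏ p, entryMass π v p (y p)

/-- The probability that the first `n` labels are `v`. -/
noncomputable def prior (α : PMF (Fin Q)) (v : Fin n → Fin Q) : ℝ := ∏ i, (α (v i)).toReal

theorem edgeMass_nonneg (p : unitInterval) (b : Bool) : 0 ≤ edgeMass p b := by
  unfold edgeMass
  split_ifs
  · exact p.2.1
  · linarith [p.2.2]

theorem entryMass_nonneg (π : EdgeParam Q) (v : Fin n → Fin Q) (p : Fin n × Fin n) (b : Bool) :
    0 ≤ entryMass π v p b := by
  unfold entryMass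
  split_ifs
  exacts [le_rfl, zero_le_one, edgeMass_nonneg _ _]

theorem likelihood_nonneg (π : EdgeParam Q) (v : Fin n → Fin Q) (y : Fin n × Fin n → Bool) :
    0 ≤ likelihood π v y :=
  Finset.prod_nonneg fun _ _ => entryMass_nonneg _ _ _ _

theorem prior_nonneg (α : PMF (Fin Q)) (v : Fin n → Fin Q) : 0 ≤ prior α v :=
  Finset.prod_nonneg fun _ _ => ENNReal.toReal_nonneg

theorem bernoulliMeasure_real_singleton (p : unitInterval) (b : Bool) :
    (bernoulliMeasure true false p).real {b} = edgeMass p b := by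
  cases b <;> simp [edgeMass]

theorem entryLaw_real_singleton (π : EdgeParam Q) (z : LabelSeq Q) (p : Fin n × Fin n)
    (b : Bool) :
    (entryLaw π z (p.1, p.2)).real {b} = entryMass π (labels n z) p b := by
  unfold entryLaw entryMass
  simp only [Fin.val_inj]
  split_ifs with h1 h2
  · simp [measureReal_def, h2]
  · simp [measureReal_def, h2]
  · exact bernoulliMeasure_real_singleton _ _

theorem measurable_adj : Measurable (adj n) :=
  measurable_pi_lambda _ fun _ => measurable_pi_apply _

theorem measurable_labels : Measurable (labels n : LabelSeq Q → Fin n → Fin Q) :=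
  measurable_pi_lambda _ fun _ => measurable_pi_apply _

theorem edgeLaw_real_adj_eq (π : EdgeParam Q) (z : LabelSeq Q) (y : Fin n × Fin n → Bool) :
    (edgeLaw π z).real {x | adj n x = y} = likelihood π (labels n z) y := by
  have h := infinitePi_real_eval_eq (entryLaw π z)
    (Function.Embedding.prodMap (Fin.valEmbedding (n := n)) (Fin.valEmbedding (n := n))) y
  rw [likelihood, edgeLaw, ← Finset.prod_congr rfl fun p _ => entryLaw_real_singleton π z p (y p)]
  refine Eq.trans ?_ h
  congr 1
  ext x
  simp [funext_iff, adj]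

theorem labelLaw_real_labels_eq (α : PMF (Fin Q)) (v : Fin n → Fin Q) :
    (labelLaw α).real {z | labels n z = v} = prior α v := by
  have h := infinitePi_real_eval_eq (fun _ : ℕ => α.toMeasure) (Fin.valEmbedding (n := n)) v
  rw [prior, labelLaw]
  simp only [measureReal_def, PMF.toMeasure_apply_singleton _ _ (measurableSet_singleton _)] at h
  rw [← h, measureReal_def]
  congr 2
  ext x
  simp [funext_iff, labels]

theorem law_real_labels_adj_eq (α : PMF (Fin Q)) (π : EdgeParam Q) (v : Fin n → Fin Q)
    (y : Fin n × Fin n → Bool) :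
    (law α π).real {ω | (labels n ω.1, adj n ω.2) = (v, y)} = prior α v * likelihood π v y := by
  have hset : {ω : LabelSeq Q × AdjMatrix | (labels n ω.1, adj n ω.2) = (v, y)}
      = {z | labels n z = v} ×ˢ {x | adj n x = y} := by
    ext ω
    simp
  have hs : MeasurableSet {z : LabelSeq Q | labels n z = v} :=
    measurable_labels (measurableSet_singleton v)
  have hc : ∀ z ∈ {z : LabelSeq Q | labels n z = v},
      edgeKernel π z {x | adj n x = y} = ENNReal.ofReal (likelihood π v y) := by
    intro z hz
    rw [← show labels n z = v from hz, ← edgeLaw_real_adj_eq, ofReal_measureReal]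
    rfl
  have hy : MeasurableSet {x : AdjMatrix | adj n x = y} :=
    measurable_adj (measurableSet_singleton y)
  rw [hset, measureReal_def, law, Measure.compProd_apply_prod hs hy,
    setLIntegral_congr_fun hs hc, setLIntegral_const, ENNReal.toReal_mul,
    ENNReal.toReal_ofReal (likelihood_nonneg _ _ _), ← measureReal_def, labelLaw_real_labels_eq, mul_comm]

open scoped Classical in
theorem edgeLaw_real_adj_mem (π : EdgeParam Q) (z : LabelSeq Q)
    (S : Set (Fin n × Fin n → Bool)) :
    (edgeLaw π z).real {x | adj n x ∈ S}
      = ∑ y, if y ∈ S then likelihood π (labels n z) y else 0 := by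
  simp only [measureReal_mem_eq_sum _ measurable_adj, edgeLaw_real_adj_eq]

open scoped Classical in
theorem law_real_labels_adj_mem (α : PMF (Fin Q)) (π : EdgeParam Q)
    (S : Set ((Fin n → Fin Q) × (Fin n × Fin n → Bool))) :
    (law α π).real {ω | (labels n ω.1, adj n ω.2) ∈ S}
      = ∑ v, ∑ y, if (v, y) ∈ S then prior α v * likelihood π v y else 0 := by
  have hm : Measurable fun ω : LabelSeq Q × AdjMatrix => (labels n ω.1, adj n ω.2) :=
    (measurable_labels.comp measurable_fst).prodMk (measurable_adj.comp measurable_snd)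
  rw [measureReal_mem_eq_sum _ hm, Fintype.sum_prod_type]
  simp only [law_real_labels_adj_eq]

theorem sum_edgeMass (p : unitInterval) : ∑ b, edgeMass p b = 1 := by
  simp [edgeMass]

theorem sum_likelihood (π : EdgeParam Q) (v : Fin n → Fin Q) : ∑ y, likelihood π v y = 1 := by
  unfold likelihood
  rw [← Fintype.prod_sum fun p b => entryMass π v p b]
  refine Finset.prod_eq_one fun p _ => ?_
  unfold entryMass
  split_ifs
  · simp
  · exact sum_edgeMass _

theorem sum_toReal_eq_one (α : PMF (Fin Q)) : ∑ q, (α q).toReal = 1 := by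
  rw [← ENNReal.toReal_sum fun q _ => α.apply_ne_top q,
    ← tsum_fintype (L := .unconditional _), α.tsum_coe]
  rfl

theorem sum_prior (α : PMF (Fin Q)) : ∑ v : Fin n → Fin Q, prior α v = 1 := by
  unfold prior
  rw [← Fintype.prod_sum fun _ q => (α q).toReal]
  exact Finset.prod_eq_one fun p _ => sum_toReal_eq_one α

/-! ### The posterior ratio as a likelihood ratio -/

open scoped Classical in
/-- The probability that the labels are equivalent to `v` and the adjacency matrix is `y`. -/
noncomputable def sameClassMass (α : PMF (Fin Q)) (π : EdgeParam Q) (v : Fin n → Fin Q)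
    (y : Fin n × Fin n → Bool) : ℝ :=
  ∑ u with (labelSetoid π n) v u, prior α u * likelihood π u y

open scoped Classical in
/-- The probability that the labels are not equivalent to `v` and the adjacency matrix is `y`. -/
noncomputable def otherClassMass (α : PMF (Fin Q)) (π : EdgeParam Q) (v : Fin n → Fin Q)
    (y : Fin n × Fin n → Bool) : ℝ :=
  ∑ u with ¬ (labelSetoid π n) v u, prior α u * likelihood π u y

theorem law_real_adj_inter_labels (α : PMF (Fin Q)) (π : EdgeParam Q) (x : AdjMatrix)
    (P : (Fin n → Fin Q) → Prop) [DecidablePred P] :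
    (law α π).real ({ω | adj n ω.2 = adj n x} ∩ {ω | P (labels n ω.1)})
      = ∑ u with P u, prior α u * likelihood π u (adj n x) := by
  have h := law_real_labels_adj_mem α π {w | P w.1 ∧ w.2 = adj n x}
  simp only [Set.mem_ofPred_eq] at h
  rw [Finset.sum_filter, Set.inter_comm]
  refine h.trans (Finset.sum_congr rfl fun u _ => ?_)
  by_cases hu : P u <;> simp [hu]

open scoped Classical in
/-- If the sum of the posterior ratios exceeds `t`, then so does the ratio of the joint masses;
multiplied out, so that nothing is divided by a vanishing mass. -/
theorem mul_sameClassMass_le_otherClassMass (α : PMF (Fin Q)) (π : EdgeParam Q) {t : ℝ}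
    (ht : 0 < t) (z : LabelSeq Q) (x : AdjMatrix)
    (h : ENNReal.ofReal t < posteriorRatioSum α π n z x) :
    t * sameClassMass α π (labels n z) (adj n x)
      ≤ otherClassMass α π (labels n z) (adj n x) := by
  set μ := law α π
  set s : Set (LabelSeq Q × AdjMatrix) := {ω | adj n ω.2 = adj n x}
  have hs : MeasurableSet s :=
    (measurable_adj.comp measurable_snd) (measurableSet_singleton (adj n x))
  have hcls : ∀ T : Set (Fin n → Fin Q),
      MeasurableSet {ω : LabelSeq Q × AdjMatrix | labels n ω.1 ∈ T} := fun T =>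
    (measurable_labels.comp measurable_fst) (.of_discrete (s := T))
  have hcls' : ∀ c : LabelClass π n,
      MeasurableSet {ω : LabelSeq Q × AdjMatrix | labelClass π n ω.1 = c} := fun c =>
    hcls {v | Quotient.mk (labelSetoid π n) v = c}
  set c₀ := labelClass π n z
  have hA : μ.real (s ∩ {ω | labelClass π n ω.1 = c₀})
      = sameClassMass α π (labels n z) (adj n x) := by
    have := law_real_adj_inter_labels α π x fun v =>
      Quotient.mk (labelSetoid π n) v = Quotient.mk (labelSetoid π n) (labels n z)
    refine this.trans ?_
    unfold sameClassMass
    refine Finset.sum_congr (Finset.filter_congr fun u _ => ?_) fun _ _ => rfl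
    exact (Quotient.eq (r := labelSetoid π n)).trans
      ⟨(labelSetoid π n).symm, (labelSetoid π n).symm⟩
  have hB : μ.real (s ∩ {ω | labelClass π n ω.1 ≠ c₀})
      = otherClassMass α π (labels n z) (adj n x) := by
    have := law_real_adj_inter_labels α π x fun v =>
      Quotient.mk (labelSetoid π n) v ≠ Quotient.mk (labelSetoid π n) (labels n z)
    refine this.trans ?_
    unfold otherClassMass
    refine Finset.sum_congr (Finset.filter_congr fun u _ => not_congr ?_) fun _ _ => rfl
    exact (Quotient.eq (r := labelSetoid π n)).trans
      ⟨(labelSetoid π n).symm, (labelSetoid π n).symm⟩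
  have hR : posteriorRatioSum α π n z x
      = (μ s)⁻¹ * μ (s ∩ {ω | labelClass π n ω.1 ≠ c₀})
        / ((μ s)⁻¹ * μ (s ∩ {ω | labelClass π n ω.1 = c₀})) := by
    have hp : ∀ c, posterior α π n x c = (μ s)⁻¹ * μ (s ∩ {ω | labelClass π n ω.1 = c}) :=
      fun c => cond_apply hs _ _
    unfold posteriorRatioSum
    simp only [hp, div_eq_mul_inv]
    rw [ENNReal.tsum_mul_right, ENNReal.tsum_mul_left, ← measure_iUnion]
    · congr 3
      ext ω
      simp only [Set.mem_iUnion, Set.mem_inter_iff, Set.mem_ofPred_eq, Subtype.exists, s]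
      aesop
    · intro a b hab
      refine Set.disjoint_left.2 fun ω h1 h2 => hab (Subtype.ext ?_)
      rw [← show labelClass π n ω.1 = a from h1.2, ← show labelClass π n ω.1 = b from h2.2]
    · exact fun c => hs.inter (hcls' c)
  rw [← hA, ← hB]
  rcases eq_or_ne (μ s) 0 with h0 | h0
  · have : μ.real (s ∩ {ω | labelClass π n ω.1 = c₀}) = 0 := by
      rw [measureReal_def, measure_mono_null Set.inter_subset_left h0, ENNReal.toReal_zero]
    rw [this, mul_zero]
    exact measureReal_nonneg
  · rw [hR, ENNReal.mul_div_mul_left _ _ (by simp) (by simp [h0])] at h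
    have h1 := ENNReal.mul_le_of_le_div h.le
    have h2 := ENNReal.toReal_mono (measure_ne_top _ _) h1
    rwa [ENNReal.toReal_mul, ENNReal.toReal_ofReal ht.le] at h2

/-! ### Pairs of vertices that separate two label vectors -/

open scoped Classical in
/-- The ordered pairs of distinct vertices whose connection probabilities differ under the
labels `u` and `v`. -/
noncomputable def differingPairs (π : EdgeParam Q) (u v : Fin n → Fin Q) :
    Finset (Fin n × Fin n) :=
  {p | p.1 ≠ p.2 ∧ π (u p.1) (u p.2) ≠ π (v p.1) (v p.2)}

theorem mem_differingPairs {π : EdgeParam Q} {u v : Fin n → Fin Q} {p : Fin n × Fin n} :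
    p ∈ differingPairs π u v ↔ p.1 ≠ p.2 ∧ π (u p.1) (u p.2) ≠ π (v p.1) (v p.2) := by
  simp [differingPairs]

/-- A map of the classes that preserves the connection probabilities is injective when the classes
are distinguishable. -/
theorem injective_of_preserves {π : EdgeParam Q} (hA1 : Distinguishable π) {f : Fin Q → Fin Q}
    (hf : ∀ q l, π (f q) (f l) = π q l) : Function.Injective f := by
  intro q q' hq
  by_contra hne
  obtain ⟨l, h | h⟩ := hA1 q q' hne
  · exact h (by rw [← hf q, ← hf q', hq])
  · exact h (by rw [← hf l q, ← hf l q', hq])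

/-- Among the vertices with a given label under `v`, some label of `u` has at least the average
frequency. -/
theorem exists_plurality_label (hQ : 0 < Q) {δ : ℝ} (u v : Fin n → Fin Q) (q : Fin Q)
    (hcount : δ * n ≤ (Finset.univ.filter fun i => v i = q).card) :
    ∃ l, δ * n / Q ≤ (Finset.univ.filter fun i => v i = q ∧ u i = l).card := by
  have : Nonempty (Fin Q) := ⟨q⟩
  obtain ⟨l, -, hl⟩ := Finset.exists_le_card_fiber_of_nsmul_le_card_of_maps_to
    (s := Finset.univ.filter fun i => v i = q) (t := (Finset.univ : Finset (Fin Q))) (f := u)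
    (b := δ * n / Q) (fun _ _ => Finset.mem_univ _) Finset.univ_nonempty (by
      rw [Finset.card_univ, Fintype.card_fin, nsmul_eq_mul, mul_div_cancel₀ _ (by positivity)]
      exact hcount)
  refine ⟨l, hl.trans_eq ?_⟩
  rw [Finset.filter_filter]

/-- If the plurality map `f` preserves the connection probabilities, then every vertex at which
`u` differs from `f ∘ v` is in a differing pair with each vertex of some large set on which they
agree. -/
theorem hammingDist_mul_le_card_differingPairs {π : EdgeParam Q} (hA1 : Distinguishable π)
    (u v : Fin n → Fin Q) {f : Fin Q → Fin Q} (hf : ∀ q l, π (f q) (f l) = π q l) {m : ℝ}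
    (hm : ∀ q, m ≤ (Finset.univ.filter fun i => v i = q ∧ u i = f q).card) :
    m * hammingDist u (f ∘ v) ≤ 2 * (differingPairs π u v).card := by
  have hsurj : Function.Surjective f :=
    Finite.surjective_of_injective (injective_of_preserves hA1 hf)
  set D := differingPairs π u v
  set D' := D ∪ D.map (Equiv.prodComm _ _).toEmbedding with hD'
  have hcard : D'.card ≤ 2 * D.card := by
    refine (Finset.card_union_le _ _).trans ?_
    rw [Finset.card_map]
    omega
  have hfib : ∀ i ∈ Finset.univ.filter (fun i => u i ≠ (f ∘ v) i),
      m ≤ (D'.filter fun p => p.1 = i).card := by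
    intro i hi
    simp only [Finset.mem_filter, Finset.mem_univ, true_and, Function.comp_apply] at hi
    obtain ⟨l', hl'⟩ := hA1 _ _ hi
    obtain ⟨k, rfl⟩ := hsurj l'
    refine (hm k).trans (Nat.cast_le.2 ?_)
    refine Finset.card_le_card_of_injOn (fun j => (i, j)) ?_ (fun a _ b _ h => (Prod.mk.inj h).2)
    intro j hj
    simp only [Finset.coe_filter, Finset.mem_univ, true_and, Set.mem_ofPred_eq] at hj
    have hij : i ≠ j := by
      rintro rfl
      exact hi (by rw [hj.2, hj.1])
    simp only [Finset.coe_filter, Set.mem_ofPred_eq, and_true, hD', Finset.mem_union,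
      Finset.mem_map_equiv, D, mem_differingPairs, Equiv.prodComm_symm,
      Equiv.prodComm_apply, Prod.swap]
    rcases hl' with h | h
    · left
      refine ⟨hij, ?_⟩
      rwa [hj.2, hj.1, ← hf (v i) k]
    · right
      refine ⟨hij.symm, ?_⟩
      rwa [hj.2, hj.1, ← hf k (v i)]
  have hsum := Finset.card_nsmul_le_sum _ _ _ hfib
  rw [nsmul_eq_mul, ← Nat.cast_sum] at hsum
  have hle : ∑ i ∈ Finset.univ.filter (fun i => u i ≠ (f ∘ v) i),
      (D'.filter fun p => p.1 = i).card ≤ D'.card := by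
    rw [Finset.card_eq_sum_card_fiberwise (f := Prod.fst) (s := D') (t := Finset.univ)
      (fun _ _ => Finset.mem_coe.2 (Finset.mem_univ _))]
    exact Finset.sum_le_sum_of_subset (Finset.filter_subset _ _)
  rw [mul_comm]
  refine hsum.trans ?_
  exact_mod_cast hle.trans hcard

/-- Two large sets of vertices with constant labels under `u` and `v`, whose connection
probabilities differ, give quadratically many differing pairs. -/
theorem sq_le_card_differingPairs {π : EdgeParam Q} (u v : Fin n → Fin Q) {q l q' l' : Fin Q}
    (hne : π q' l' ≠ π q l) {m : ℝ} (hm2 : 2 ≤ m)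
    (hq : m ≤ (Finset.univ.filter fun i => v i = q ∧ u i = q').card)
    (hl : m ≤ (Finset.univ.filter fun i => v i = l ∧ u i = l').card) :
    m * m / 2 ≤ (differingPairs π u v).card := by
  set A := Finset.univ.filter fun i => v i = q ∧ u i = q' with hA
  set B := Finset.univ.filter fun i => v i = l ∧ u i = l' with hB
  set D := differingPairs π u v with hD
  have hsub : (A ×ˢ B) \ A.map ⟨fun i => (i, i), fun a b h => (Prod.mk.inj h).1⟩ ⊆ D := by
    rintro ⟨i, j⟩ hp
    simp only [Finset.mem_sdiff, Finset.mem_product, Finset.mem_map, not_exists, not_and] at hp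
    obtain ⟨⟨hi, hj⟩, hdiag⟩ := hp
    have hi' := hi
    simp only [hA, hB, Finset.mem_filter, Finset.mem_univ, true_and] at hi hj
    simp only [hD, mem_differingPairs, hi, hj]
    exact ⟨fun h => hdiag i hi' (Prod.ext rfl h), hne⟩
  have hcard := (Finset.le_card_sdiff _ _).trans (Finset.card_le_card hsub)
  rw [Finset.card_map, Finset.card_product] at hcard
  have hcard' : (A.card * B.card : ℝ) ≤ D.card + A.card := by
    exact_mod_cast Nat.sub_le_iff_le_add.1 hcard
  nlinarith

/-- If every class is frequent under `v`, then some symmetry `σ` of the connection probabilities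
makes the number of pairs separating `u` from `v` at least proportional to `n` times the Hamming
distance of `u` to `σ ∘ v`. -/
theorem exists_symmetry_mul_hammingDist_le {π : EdgeParam Q} (hA1 : Distinguishable π)
    (hQ : 0 < Q) {δ : ℝ} (hδ : 0 < δ) (hδ1 : δ ≤ 1) (hn : 2 * Q ≤ δ * n) (u v : Fin n → Fin Q)
    (hcount : ∀ q, δ * n ≤ (Finset.univ.filter fun i => v i = q).card) :
    ∃ σ ∈ symmetries π, δ ^ 2 / (2 * Q ^ 2) * n * hammingDist u (σ ∘ v)
      ≤ (differingPairs π u v).card := by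
  have hQ' : (1 : ℝ) ≤ Q := by exact_mod_cast hQ
  have hn0 : (0 : ℝ) ≤ n := Nat.cast_nonneg n
  choose f hf using fun q => exists_plurality_label hQ u v q (hcount q)
  by_cases hpres : ∀ q l, π (f q) (f l) = π q l
  · have hbij := Finite.injective_iff_bijective.1 (injective_of_preserves hA1 hpres)
    refine ⟨Equiv.ofBijective f hbij, hpres, ?_⟩
    have h := hammingDist_mul_le_card_differingPairs hA1 u v hpres hf
    have hc : δ ^ 2 / (2 * Q ^ 2) * n ≤ δ * n / Q / 2 := by
      have h1 : δ / Q ≤ 1 := (div_le_one (by positivity)).2 (by linarith)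
      calc δ ^ 2 / (2 * Q ^ 2) * n = (δ / Q) * (δ * n / Q / 2) := by field_simp
        _ ≤ 1 * (δ * n / Q / 2) := by gcongr
        _ = _ := one_mul _
    have h2 := mul_le_mul_of_nonneg_right hc (Nat.cast_nonneg (α := ℝ) (hammingDist u (f ∘ v)))
    refine h2.trans ?_
    linarith
  · push Not at hpres
    obtain ⟨q, l, hne⟩ := hpres
    refine ⟨1, fun _ _ => rfl, ?_⟩
    have h := sq_le_card_differingPairs u v hne
      (by rw [le_div_iff₀ (by positivity)]; exact hn) (hf q) (hf l)
    refine le_trans ?_ h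
    have hH : (hammingDist u ((1 : Equiv.Perm (Fin Q)) ∘ v) : ℝ) ≤ n := by
      exact_mod_cast (hammingDist_le_card_fintype (x := u)
        (y := (1 : Equiv.Perm (Fin Q)) ∘ v)).trans_eq (Fintype.card_fin n)
    calc δ ^ 2 / (2 * Q ^ 2) * n * hammingDist u ((1 : Equiv.Perm (Fin Q)) ∘ v)
        ≤ δ ^ 2 / (2 * Q ^ 2) * n * n := by gcongr
      _ = _ := by field_simp

/-! ### Bhattacharyya affinities -/

theorem two_mul_sqrt_mul_le {a b : ℝ} (ha : 0 ≤ a) (hb : 0 ≤ b) : 2 * √(a * b) ≤ a + b := by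
  rw [Real.sqrt_mul ha]
  nlinarith [sq_nonneg (√a - √b), Real.sq_sqrt ha, Real.sq_sqrt hb]

theorem two_mul_sqrt_mul_lt {a b : ℝ} (ha : 0 ≤ a) (hb : 0 ≤ b) (hab : a ≠ b) :
    2 * √(a * b) < a + b := by
  rw [Real.sqrt_mul ha]
  have h : 0 < (√a - √b) ^ 2 := by
    rw [sq_pos_iff, sub_ne_zero]
    exact fun h => hab ((Real.sqrt_inj ha hb).1 h)
  nlinarith [Real.sq_sqrt ha, Real.sq_sqrt hb]

theorem sum_sqrt_edgeMass_lt_one {p q : unitInterval} (h : p ≠ q) :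
    ∑ b, √(edgeMass p b * edgeMass q b) < 1 := by
  have h1 := two_mul_sqrt_mul_lt p.2.1 q.2.1 (fun h' => h (Subtype.ext h'))
  have h2 := two_mul_sqrt_mul_le (sub_nonneg.2 p.2.2) (sub_nonneg.2 q.2.2)
  simp only [edgeMass, Fintype.sum_bool, if_true, Bool.false_eq_true, if_false]
  linarith

/-- The affinities of distinct connection probabilities are bounded away from `1`, uniformly,
because `π` takes finitely many values. -/
theorem edgeParam_sum_sqrt_le_exp_neg (π : EdgeParam Q) :
    ∃ θ : ℝ, 0 < θ ∧ ∀ q l q' l', π q l ≠ π q' l' →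
      ∑ b, √(edgeMass (π q l) b * edgeMass (π q' l') b) ≤ Real.exp (-θ) := by
  have hlim : Filter.Tendsto (fun θ : ℝ => Real.exp (-θ)) (nhdsWithin 0 (Set.Ioi 0)) (nhds 1) := by
    have : Continuous fun θ : ℝ => Real.exp (-θ) := by fun_prop
    simpa using (this.tendsto 0).mono_left nhdsWithin_le_nhds
  have hev : ∀ᶠ θ : ℝ in nhdsWithin 0 (Set.Ioi 0), ∀ q l q' l', π q l ≠ π q' l' →
      ∑ b, √(edgeMass (π q l) b * edgeMass (π q' l') b) ≤ Real.exp (-θ) := by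
    simp only [Filter.eventually_all]
    exact fun q l q' l' h =>
      (hlim.eventually_const_lt (sum_sqrt_edgeMass_lt_one h)).mono fun _ => le_of_lt
  obtain ⟨θ, h, hθ⟩ := (hev.and self_mem_nhdsWithin).exists
  exact ⟨θ, hθ, h⟩

/-- The Bhattacharyya affinity of the conditional laws given two label vectors decreases
exponentially in the number of pairs of vertices that separate them. -/
theorem sum_sqrt_likelihood_le {π : EdgeParam Q} {θ : ℝ}
    (hθ : ∀ q l q' l', π q l ≠ π q' l' →
      ∑ b, √(edgeMass (π q l) b * edgeMass (π q' l') b) ≤ Real.exp (-θ))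
    (u v : Fin n → Fin Q) :
    ∑ y, √(likelihood π u y * likelihood π v y)
      ≤ Real.exp (-θ) ^ (differingPairs π u v).card := by
  classical
  have hfac : ∀ y : Fin n × Fin n → Bool, √(likelihood π u y * likelihood π v y)
      = ∏ p, √(entryMass π u p (y p) * entryMass π v p (y p)) := by
    intro y
    rw [likelihood, likelihood, ← Finset.prod_mul_distrib, Real.sqrt_eq_rpow,
      ← Real.finsetProd_rpow _ _ fun p _ => mul_nonneg (entryMass_nonneg _ _ _ _)
        (entryMass_nonneg _ _ _ _)]
    simp only [Real.sqrt_eq_rpow]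
  simp only [hfac]
  rw [← Fintype.prod_sum fun p b => √(entryMass π u p b * entryMass π v p b)]
  calc ∏ p, ∑ b, √(entryMass π u p b * entryMass π v p b)
      ≤ ∏ p, if p ∈ differingPairs π u v then Real.exp (-θ) else 1 := by
        refine Finset.prod_le_prod
          (fun p _ => Finset.sum_nonneg fun b _ => Real.sqrt_nonneg _) fun p _ => ?_
        by_cases hp : p.1 = p.2
        · rw [if_neg (by simp [mem_differingPairs, hp])]
          simp [entryMass, hp]
        · simp only [entryMass, hp, if_false, mem_differingPairs, ne_eq, not_false_eq_true,
            true_and]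
          split_ifs with h
          · simp only [h, ← pow_two, Real.sqrt_sq (edgeMass_nonneg _ _), sum_edgeMass, le_refl]
          · exact hθ _ _ _ _ h
    _ = _ := by simp [Finset.prod_ite_mem, Finset.prod_const]

/-! ### Summing over label vectors by Hamming distance -/

theorem prior_le_inv_pow_mul_prior {α : PMF (Fin Q)} {γ : ℝ} (hγ : 0 < γ)
    (hα : ∀ q, γ ≤ (α q).toReal) (u w : Fin n → Fin Q) :
    prior α u ≤ γ⁻¹ ^ hammingDist u w * prior α w := by
  have hone : ∀ q, (α q).toReal ≤ 1 := fun q =>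
    ENNReal.toReal_le_of_le_ofReal zero_le_one (by simpa using α.coe_le_one q)
  have : γ⁻¹ ^ hammingDist u w = ∏ i, if u i ≠ w i then γ⁻¹ else 1 := by
    rw [Finset.prod_ite, Finset.prod_const, Finset.prod_const_one, mul_one, hammingDist]
  rw [this, prior, prior, ← Finset.prod_mul_distrib]
  refine Finset.prod_le_prod (fun _ _ => ENNReal.toReal_nonneg) fun i _ => ?_
  split_ifs with h
  · refine (hone _).trans ?_
    rw [inv_mul_eq_div, one_le_div hγ]
    exact hα _
  · rw [one_mul, not_not.1 h]

theorem prod_fin_le_pow {f : Fin n → ℝ} {c : ℝ} (h0 : ∀ i, 0 ≤ f i) (h : ∀ i, f i ≤ c) :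
    ∏ i, f i ≤ c ^ n :=
  (Finset.prod_le_prod (fun i _ => h0 i) fun i _ => h i).trans_eq (Fin.prod_const n c)

theorem sum_pow_hammingDist_le (w : Fin n → Fin Q) {a : ℝ} (ha : 0 ≤ a) :
    ∑ u : Fin n → Fin Q, a ^ hammingDist u w ≤ Real.exp (n * (Q * a)) := by
  have : ∀ u : Fin n → Fin Q, a ^ hammingDist u w = ∏ i, if u i ≠ w i then a else 1 := by
    intro u
    rw [Finset.prod_ite, Finset.prod_const, Finset.prod_const_one, mul_one, hammingDist]
  simp only [this]
  rw [← Fintype.prod_sum fun i q => if q ≠ w i then a else 1, Real.exp_nat_mul]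
  refine prod_fin_le_pow
    (fun i => Finset.sum_nonneg fun q _ => by split_ifs <;> positivity) fun i => ?_
  calc ∑ q, (if q ≠ w i then a else 1) ≤ ∑ q, (a + if q = w i then 1 else 0) := by
        refine Finset.sum_le_sum fun q _ => ?_
        split_ifs <;> simp_all
    _ = Q * a + 1 := by simp [Finset.sum_add_distrib]
    _ ≤ Real.exp (Q * a) := Real.add_one_le_exp _

theorem exp_sub_one_le_mul_exp (x : ℝ) : Real.exp x - 1 ≤ x * Real.exp x := by
  have h := Real.add_one_le_exp (-x)
  have h1 : Real.exp x * Real.exp (-x) = 1 := by rw [← Real.exp_add]; simp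
  nlinarith [Real.exp_pos x]

/-- Summing the powers `a ^ d` of the Hamming distance `d` of `u` to a permuted copy of `v` that
depends on `u`: each of the `Q!` permutations contributes at most `(1 + Q a) ^ n - 1`, the term
`d = 0` being excluded. -/
theorem sum_pow_hammingDist_symmetries_le (v : Fin n → Fin Q)
    (S : Finset (Fin n → Fin Q)) (σ : (Fin n → Fin Q) → Equiv.Perm (Fin Q))
    (hS : ∀ u ∈ S, u ≠ σ u ∘ v) {a : ℝ} (ha : 0 ≤ a) :
    ∑ u ∈ S, a ^ hammingDist u (σ u ∘ v)
      ≤ Fintype.card (Equiv.Perm (Fin Q)) * (n * (Q * a) * Real.exp (n * (Q * a))) := by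
  have hterm : ∀ τ : Equiv.Perm (Fin Q), ∑ u with u ≠ τ ∘ v, a ^ hammingDist u (τ ∘ v)
      ≤ n * (Q * a) * Real.exp (n * (Q * a)) := by
    intro τ
    have h1 := Finset.add_sum_erase Finset.univ (fun u => a ^ hammingDist u (τ ∘ v))
      (Finset.mem_univ (τ ∘ v))
    rw [Finset.filter_ne']
    simp only [hammingDist_self, pow_zero] at h1
    linarith [sum_pow_hammingDist_le (τ ∘ v) ha, exp_sub_one_le_mul_exp (n * (Q * a))]
  calc ∑ u ∈ S, a ^ hammingDist u (σ u ∘ v)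
      ≤ ∑ u ∈ S, ∑ τ : Equiv.Perm (Fin Q),
          if u ≠ τ ∘ v then a ^ hammingDist u (τ ∘ v) else 0 := by
        refine Finset.sum_le_sum fun u hu => ?_
        refine le_trans ?_ (Finset.single_le_sum
          (f := fun τ : Equiv.Perm (Fin Q) =>
            if u ≠ τ ∘ v then a ^ hammingDist u (τ ∘ v) else 0)
          (fun τ _ => by split_ifs <;> positivity) (Finset.mem_univ (σ u)))
        rw [if_pos (hS u hu)]
    _ ≤ ∑ u, ∑ τ : Equiv.Perm (Fin Q),
          if u ≠ τ ∘ v then a ^ hammingDist u (τ ∘ v) else 0 :=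
        Finset.sum_le_sum_of_subset_of_nonneg (Finset.subset_univ _) fun u _ _ =>
          Finset.sum_nonneg fun τ _ => by split_ifs <;> positivity
    _ = ∑ τ : Equiv.Perm (Fin Q), ∑ u with u ≠ τ ∘ v, a ^ hammingDist u (τ ∘ v) := by
        rw [Finset.sum_comm]
        simp only [Finset.sum_filter]
    _ ≤ ∑ _τ : Equiv.Perm (Fin Q), n * (Q * a) * Real.exp (n * (Q * a)) :=
        Finset.sum_le_sum fun τ _ => hterm τ
    _ = _ := by rw [Finset.sum_const, Finset.card_univ, nsmul_eq_mul]

/-! ### The error probability for a fixed label vector -/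

theorem likelihood_comp_symmetry {π : EdgeParam Q} {σ : Equiv.Perm (Fin Q)}
    (hσ : σ ∈ symmetries π) (v : Fin n → Fin Q) (y : Fin n × Fin n → Bool) :
    likelihood π (σ ∘ v) y = likelihood π v y := by
  unfold likelihood entryMass
  simp only [Function.comp_apply, hσ _ _]

theorem sqrt_sum_le_sum_sqrt {ι : Type*} (s : Finset ι) {f : ι → ℝ} (hf : ∀ i, 0 ≤ f i) :
    √(∑ i ∈ s, f i) ≤ ∑ i ∈ s, √(f i) := by
  rw [Real.sqrt_le_left (Finset.sum_nonneg fun _ _ => Real.sqrt_nonneg _)]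
  refine le_trans (le_of_eq ?_) (Finset.sum_sq_le_sq_sum_of_nonneg fun i _ => Real.sqrt_nonneg _)
  exact Finset.sum_congr rfl fun i _ => (Real.sq_sqrt (hf i)).symm

/-- The adjacency matrices for which the label vectors not equivalent to `v` jointly carry at
least `t` times the mass of those equivalent to `v`. -/
def errorSet (α : PMF (Fin Q)) (π : EdgeParam Q) (t : ℝ) (v : Fin n → Fin Q) :
    Set (Fin n × Fin n → Bool) :=
  {y | t * sameClassMass α π v y ≤ otherClassMass α π v y}

open scoped Classical in
/-- On the error set, the likelihood of `v` is dominated by square-root likelihood ratios. The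
prior of `u` is compared with that of a symmetric image `σ u ∘ v`, at the cost of a factor `γ⁻¹`
for each vertex where they differ. -/
theorem sqrt_mul_likelihood_le {α : PMF (Fin Q)} {π : EdgeParam Q} {γ t : ℝ} (hγ : 0 < γ)
    (hα : ∀ q, γ ≤ (α q).toReal) (ht : 0 < t) (v : Fin n → Fin Q)
    (σ : (Fin n → Fin Q) → Equiv.Perm (Fin Q)) (hσ : ∀ u, σ u ∈ symmetries π)
    {y : Fin n × Fin n → Bool} (hy : y ∈ errorSet α π t v) :
    √t * likelihood π v y ≤ ∑ u with ¬ (labelSetoid π n) v u,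
      √γ⁻¹ ^ hammingDist u (σ u ∘ v) * √(likelihood π u y * likelihood π v y) := by
  have hLv := likelihood_nonneg π v y
  rcases hLv.eq_or_lt with h0 | hpos
  · rw [← h0, mul_zero]
    exact Finset.sum_nonneg fun u _ => by positivity
  have hsingle : ∀ τ ∈ symmetries π,
      prior α (τ ∘ v) * likelihood π v y ≤ sameClassMass α π v y := by
    intro τ hτ
    rw [← likelihood_comp_symmetry hτ]
    unfold sameClassMass
    refine Finset.single_le_sum (f := fun u => prior α u * likelihood π u y)
      (fun u _ => mul_nonneg (prior_nonneg _ _) (likelihood_nonneg _ _ _)) ?_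
    rw [Finset.mem_filter]
    exact ⟨Finset.mem_univ _, τ, hτ, fun i => rfl⟩
  have hsame : 0 < sameClassMass α π v y :=
    (mul_pos (Finset.prod_pos fun i _ => hγ.trans_le (hα _)) hpos).trans_le
      (hsingle 1 fun _ _ => rfl)
  have hratio : t * likelihood π v y ≤ ∑ u with ¬ (labelSetoid π n) v u,
      γ⁻¹ ^ hammingDist u (σ u ∘ v) * likelihood π u y := by
    refine le_of_mul_le_mul_left ?_ hsame
    calc sameClassMass α π v y * (t * likelihood π v y)
        = t * sameClassMass α π v y * likelihood π v y := by ring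
      _ ≤ otherClassMass α π v y * likelihood π v y := mul_le_mul_of_nonneg_right hy hLv
      _ = ∑ u with ¬ (labelSetoid π n) v u, prior α u * likelihood π u y * likelihood π v y := by
          rw [otherClassMass, Finset.sum_mul]
      _ ≤ ∑ u with ¬ (labelSetoid π n) v u, sameClassMass α π v y *
            (γ⁻¹ ^ hammingDist u (σ u ∘ v) * likelihood π u y) := by
          refine Finset.sum_le_sum fun u _ => ?_
          have hLu := likelihood_nonneg π u y
          calc prior α u * likelihood π u y * likelihood π v y
              ≤ γ⁻¹ ^ hammingDist u (σ u ∘ v) * prior α (σ u ∘ v) * likelihood π u y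
                  * likelihood π v y := by
                gcongr
                exact prior_le_inv_pow_mul_prior hγ hα _ _
            _ = prior α (σ u ∘ v) * likelihood π v y *
                  (γ⁻¹ ^ hammingDist u (σ u ∘ v) * likelihood π u y) := by ring
            _ ≤ _ := by
                gcongr
                exact hsingle _ (hσ u)
      _ = _ := (Finset.mul_sum _ _ _).symm
  calc √t * likelihood π v y = √(t * likelihood π v y) * √(likelihood π v y) := by
        rw [Real.sqrt_mul ht.le, mul_assoc, Real.mul_self_sqrt hLv]
    _ ≤ (∑ u with ¬ (labelSetoid π n) v u,
          √(γ⁻¹ ^ hammingDist u (σ u ∘ v) * likelihood π u y)) * √(likelihood π v y) := by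
        refine mul_le_mul_of_nonneg_right ((Real.sqrt_le_sqrt hratio).trans ?_)
          (Real.sqrt_nonneg _)
        exact sqrt_sum_le_sum_sqrt _ fun u => mul_nonneg (by positivity) (likelihood_nonneg _ _ _)
    _ = _ := by
        rw [Finset.sum_mul]
        refine Finset.sum_congr rfl fun u _ => ?_
        have hpow : √(γ⁻¹ ^ hammingDist u (σ u ∘ v)) = √γ⁻¹ ^ hammingDist u (σ u ∘ v) := by
          rw [Real.sqrt_eq_iff_mul_self_eq (by positivity) (by positivity), ← mul_pow,
            Real.mul_self_sqrt (by positivity)]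
        rw [Real.sqrt_mul (by positivity), Real.sqrt_mul (likelihood_nonneg _ _ _), hpow,
          mul_assoc]

open scoped Classical in
/-- The conditional probability of the error set decreases exponentially when every class is
frequent under `v`; the rate `κ = θ δ² / (2 Q²)` comes from the separation rate and the affinity. -/
theorem sum_errorSet_likelihood_le {α : PMF (Fin Q)} {π : EdgeParam Q} {γ t δ θ κ : ℝ}
    (hγ : 0 < γ) (hα : ∀ q, γ ≤ (α q).toReal) (ht : 0 < t) (hA1 : Distinguishable π)
    (hQ : 0 < Q) (hδ : 0 < δ) (hδ1 : δ ≤ 1) (hn : 2 * Q ≤ δ * n) (hθ0 : 0 < θ)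
    (hθ : ∀ q l q' l', π q l ≠ π q' l' →
      ∑ b, √(edgeMass (π q l) b * edgeMass (π q' l') b) ≤ Real.exp (-θ))
    (hκ : κ = θ * (δ ^ 2 / (2 * Q ^ 2))) (v : Fin n → Fin Q)
    (hcount : ∀ q, δ * n ≤ (Finset.univ.filter fun i => v i = q).card) :
    (∑ y, if y ∈ errorSet α π t v then likelihood π v y else 0)
      ≤ (√t)⁻¹ * (Fintype.card (Equiv.Perm (Fin Q)) *
        (Q * √γ⁻¹ * Real.exp (Q * √γ⁻¹ / κ))) * (n * Real.exp (-κ * n)) := by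
  have hκ0 : 0 < κ := by rw [hκ]; positivity
  choose σ hσ hsep using fun u =>
    exists_symmetry_mul_hammingDist_le hA1 hQ hδ hδ1 hn u v hcount
  set S := Finset.univ.filter fun u => ¬ (labelSetoid π n) v u with hS
  set a := √γ⁻¹ * Real.exp (-κ * n) with ha
  have hne : ∀ u ∈ S, u ≠ σ u ∘ v := by
    intro u hu h
    exact (Finset.mem_filter.1 hu).2 ⟨σ u, hσ u, fun i => congrFun h i⟩
  have haff : ∀ u, ∑ y, √(likelihood π u y * likelihood π v y)
      ≤ Real.exp (-κ * n) ^ hammingDist u (σ u ∘ v) := by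
    intro u
    refine (sum_sqrt_likelihood_le hθ u v).trans ?_
    rw [← Real.exp_nat_mul, ← Real.exp_nat_mul, Real.exp_le_exp, hκ]
    nlinarith [mul_le_mul_of_nonneg_left (hsep u) hθ0.le]
  have hexp : n * (Q * a) ≤ Q * √γ⁻¹ / κ := by
    have h1 : κ * n ≤ Real.exp (κ * n) := by linarith [Real.add_one_le_exp (κ * n)]
    have h2 : κ * n * Real.exp (-κ * n) ≤ 1 := by
      rw [neg_mul, Real.exp_neg, ← div_eq_mul_inv]
      exact (div_le_one (Real.exp_pos _)).2 h1
    rw [le_div_iff₀ hκ0, ha]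
    calc n * (Q * (√γ⁻¹ * Real.exp (-κ * n))) * κ
        = Q * √γ⁻¹ * (κ * n * Real.exp (-κ * n)) := by ring
      _ ≤ Q * √γ⁻¹ * 1 := by gcongr
      _ = _ := mul_one _
  have hmain : √t * (∑ y, if y ∈ errorSet α π t v then likelihood π v y else 0)
      ≤ Fintype.card (Equiv.Perm (Fin Q)) * (n * (Q * a) * Real.exp (n * (Q * a))) := by
    calc √t * (∑ y, if y ∈ errorSet α π t v then likelihood π v y else 0)
        ≤ ∑ y, ∑ u ∈ S, √γ⁻¹ ^ hammingDist u (σ u ∘ v) *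
            √(likelihood π u y * likelihood π v y) := by
          rw [Finset.mul_sum]
          refine Finset.sum_le_sum fun y _ => ?_
          split_ifs with hy
          · exact sqrt_mul_likelihood_le hγ hα ht v σ hσ hy
          · rw [mul_zero]
            exact Finset.sum_nonneg fun u _ => by positivity
      _ = ∑ u ∈ S, √γ⁻¹ ^ hammingDist u (σ u ∘ v) *
            ∑ y, √(likelihood π u y * likelihood π v y) := by
          rw [Finset.sum_comm]
          simp only [Finset.mul_sum]
      _ ≤ ∑ u ∈ S, a ^ hammingDist u (σ u ∘ v) := by
          refine Finset.sum_le_sum fun u _ => ?_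
          rw [ha, mul_pow]
          gcongr
          exact haff u
      _ ≤ _ := sum_pow_hammingDist_symmetries_le v S σ hne (by positivity)
  have hsqrt : 0 < √t := Real.sqrt_pos.2 ht
  calc (∑ y, if y ∈ errorSet α π t v then likelihood π v y else 0)
      = (√t)⁻¹ * (√t * ∑ y, if y ∈ errorSet α π t v then likelihood π v y else 0) := by
        rw [inv_mul_cancel_left₀ hsqrt.ne']
    _ ≤ (√t)⁻¹ * (Fintype.card (Equiv.Perm (Fin Q)) *
          (n * (Q * a) * Real.exp (Q * √γ⁻¹ / κ))) := by
        refine mul_le_mul_of_nonneg_left (hmain.trans ?_) (by positivity)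
        gcongr
    _ = _ := by rw [ha]; ring

/-! ### Frequencies of the random labels -/

open scoped Classical in
/-- Chernoff bound: a class of probability at least `γ` has fewer than `γ n / 2` vertices with
exponentially small probability. The exponential moment is taken of `2 ^ (-count)`. -/
theorem sum_prior_infrequent_le {α : PMF (Fin Q)} {γ : ℝ} (hγ : 0 < γ) (q : Fin Q)
    (hα : γ ≤ (α q).toReal) :
    (∑ v : Fin n → Fin Q,
        if ((Finset.univ.filter fun i => v i = q).card : ℝ) < γ / 2 * n then prior α v else 0)
      ≤ Real.exp (-(γ / 10) * n) := by
  have hpow : ∀ v : Fin n → Fin Q, (2⁻¹ : ℝ) ^ (Finset.univ.filter fun i => v i = q).card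
      = ∏ i, if v i = q then (2⁻¹ : ℝ) else 1 := by
    intro v
    rw [Finset.prod_ite, Finset.prod_const, Finset.prod_const_one, mul_one]
  have hmom : ∑ v : Fin n → Fin Q,
      prior α v * (2⁻¹ : ℝ) ^ (Finset.univ.filter fun i => v i = q).card
      ≤ Real.exp (-(γ / 2) * n) := by
    simp only [hpow, prior, ← Finset.prod_mul_distrib]
    rw [← Fintype.prod_sum fun (_ : Fin n) l => (α l).toReal * if l = q then (2⁻¹ : ℝ) else 1,
      mul_comm (-(γ / 2)), Real.exp_nat_mul]
    refine prod_fin_le_pow (fun i => Finset.sum_nonneg fun l _ =>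
      mul_nonneg ENNReal.toReal_nonneg (by split_ifs <;> positivity)) fun i => ?_
    calc ∑ l, (α l).toReal * (if l = q then (2⁻¹ : ℝ) else 1)
        = ∑ l, ((α l).toReal - if l = q then (α l).toReal / 2 else 0) := by
          refine Finset.sum_congr rfl fun l _ => ?_
          split_ifs <;> ring
      _ = 1 - (α q).toReal / 2 := by
          rw [Finset.sum_sub_distrib, sum_toReal_eq_one]
          simp
      _ ≤ -(γ / 2) + 1 := by linarith
      _ ≤ Real.exp (-(γ / 2)) := Real.add_one_le_exp _
  have hlog : Real.log 2 ≤ 0.8 := by linarith [Real.log_two_lt_d9]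
  calc (∑ v : Fin n → Fin Q,
        if ((Finset.univ.filter fun i => v i = q).card : ℝ) < γ / 2 * n then prior α v else 0)
      ≤ ∑ v : Fin n → Fin Q, Real.exp (Real.log 2 * (γ / 2 * n)) *
          (prior α v * (2⁻¹ : ℝ) ^ (Finset.univ.filter fun i => v i = q).card) := by
        refine Finset.sum_le_sum fun v _ => ?_
        have hp := prior_nonneg α v
        split_ifs with h
        · have h2 : (2⁻¹ : ℝ) ^ (Finset.univ.filter fun i => v i = q).card
              = Real.exp (-(Real.log 2 * (Finset.univ.filter fun i => v i = q).card)) := by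
            rw [mul_comm, Real.exp_neg, Real.exp_nat_mul, Real.exp_log two_pos, inv_pow]
          rw [h2, mul_left_comm, ← Real.exp_add]
          refine le_mul_of_one_le_right hp (Real.one_le_exp ?_)
          have := mul_le_mul_of_nonneg_left h.le (Real.log_nonneg one_le_two)
          linarith
        · positivity
    _ ≤ Real.exp (Real.log 2 * (γ / 2 * n)) * Real.exp (-(γ / 2) * n) := by
        rw [← Finset.mul_sum]
        gcongr
    _ ≤ _ := by
        rw [← Real.exp_add, Real.exp_le_exp]
        have : (0 : ℝ) ≤ γ / 2 * n := by positivity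
        nlinarith

/-! ### Both bounds -/

theorem sum_ite_likelihood_le_one (π : EdgeParam Q) (v : Fin n → Fin Q)
    (S : Set (Fin n × Fin n → Bool)) [DecidablePred (· ∈ S)] :
    (∑ y, if y ∈ S then likelihood π v y else 0) ≤ 1 := by
  rw [← sum_likelihood π v]
  refine Finset.sum_le_sum fun y _ => ?_
  split_ifs
  exacts [le_rfl, likelihood_nonneg _ _ _]

/-- With no vertices there is only one class of label vectors, so the sum is empty. -/
theorem posteriorRatioSum_zero (α : PMF (Fin Q)) (π : EdgeParam Q) (z : LabelSeq Q)
    (x : AdjMatrix) : posteriorRatioSum α π 0 z x = 0 := by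
  have : IsEmpty {c : LabelClass π 0 // c ≠ labelClass π 0 z} :=
    ⟨fun c => c.2 (Subsingleton.elim _ _)⟩
  exact tsum_empty

theorem edgeLaw_real_posteriorRatioSum_le (α : PMF (Fin Q)) (π : EdgeParam Q) {t : ℝ}
    (ht : 0 < t) (z : LabelSeq Q) :
    (edgeLaw π z).real {x | ENNReal.ofReal t < posteriorRatioSum α π n z x}
      ≤ (edgeLaw π z).real {x | adj n x ∈ errorSet α π t (labels n z)} :=
  measureReal_mono fun x hx => mul_sameClassMass_le_otherClassMass α π ht z x hx

open scoped Classical in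
/-- The joint error probability is at most the prior probability that some class is infrequent
plus the largest conditional error probability over the other label vectors. -/
theorem law_real_posteriorRatioSum_le {α : PMF (Fin Q)} (π : EdgeParam Q) {γ t B : ℝ}
    (hγ : 0 < γ) (hα : ∀ q, γ ≤ (α q).toReal) (ht : 0 < t) (hB : 0 ≤ B)
    (hgood : ∀ v : Fin n → Fin Q,
      (∀ q, γ / 2 * n ≤ (Finset.univ.filter fun i => v i = q).card) →
      (∑ y, if y ∈ errorSet α π t v then likelihood π v y else 0) ≤ B) :
    (law α π).real {ω | ENNReal.ofReal t < posteriorRatioSum α π n ω.1 ω.2}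
      ≤ B + Q * Real.exp (-(γ / 10) * n) := by
  set bad : (Fin n → Fin Q) → Fin Q → ℝ := fun v q =>
    if ((Finset.univ.filter fun i => v i = q).card : ℝ) < γ / 2 * n then prior α v else 0
    with hbad
  have hbad0 : ∀ v q, 0 ≤ bad v q := by
    intro v q
    have := prior_nonneg α v
    simp only [hbad]
    split_ifs <;> positivity
  have hv : ∀ v : Fin n → Fin Q,
      (∑ y, if y ∈ errorSet α π t v then prior α v * likelihood π v y else 0)
        ≤ prior α v * B + ∑ q, bad v q := by
    intro v
    have hp := prior_nonneg α v
    have hmul : (∑ y, if y ∈ errorSet α π t v then prior α v * likelihood π v y else 0)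
        = prior α v * ∑ y, if y ∈ errorSet α π t v then likelihood π v y else 0 := by
      simp only [Finset.mul_sum, mul_ite, mul_zero]
    rw [hmul]
    by_cases hc : ∀ q, γ / 2 * n ≤ (Finset.univ.filter fun i => v i = q).card
    · exact (mul_le_mul_of_nonneg_left (hgood v hc) hp).trans
        (le_add_of_nonneg_right (Finset.sum_nonneg fun q _ => hbad0 v q))
    · push Not at hc
      obtain ⟨q, hq⟩ := hc
      have h1 : prior α v ≤ ∑ q, bad v q := by
        refine le_trans ?_ (Finset.single_le_sum (fun q _ => hbad0 v q) (Finset.mem_univ q))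
        simp only [hbad, if_pos hq, le_refl]
      have h2 := mul_le_mul_of_nonneg_left
        (sum_ite_likelihood_le_one π v (errorSet α π t v)) hp
      have h3 := mul_nonneg hp hB
      linarith
  calc (law α π).real {ω | ENNReal.ofReal t < posteriorRatioSum α π n ω.1 ω.2}
      ≤ (law α π).real
          {ω | (labels n ω.1, adj n ω.2) ∈ {w | w.2 ∈ errorSet α π t w.1}} :=
        measureReal_mono fun ω hω => mul_sameClassMass_le_otherClassMass α π ht ω.1 ω.2 hω
    _ = ∑ v, ∑ y, if y ∈ errorSet α π t v then prior α v * likelihood π v y else 0 :=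
        law_real_labels_adj_mem α π _
    _ ≤ ∑ v, (prior α v * B + ∑ q, bad v q) := Finset.sum_le_sum fun v _ => hv v
    _ = B + ∑ q, ∑ v, bad v q := by
        rw [Finset.sum_add_distrib, ← Finset.sum_mul, sum_prior, one_mul, Finset.sum_comm]
    _ ≤ B + ∑ _q : Fin Q, Real.exp (-(γ / 10) * n) := by
        gcongr with q
        exact sum_prior_infrequent_le hγ q (hα q)
    _ = _ := by simp

end SBM

theorem theorem3p1 {Q : ℕ} (π : SBM.EdgeParam Q) (γ : ℝ) (hγ : 0 < γ) (hγQ : γ < 1 / (Q : ℝ))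
    (hA1 : SBM.Distinguishable π) (hA2 : SBM.EdgeTruncated π) :
    ∃ κ : ℝ, 0 < κ ∧
      ∀ α : PMF (Fin Q), SBM.ProportionsTruncated γ α → ∀ t : ℝ, 0 < t →
        (∃ C : ℝ, ∀ n₀ : ℕ, 1 ≤ n₀ → ∀ zs : SBM.LabelSeq Q, SBM.FrequenciesTruncated γ n₀ zs →
          ∀ n : ℕ, n₀ ≤ n →
            (SBM.edgeLaw π zs).real
                {x | ENNReal.ofReal t < SBM.posteriorRatioSum α π n zs x}
              ≤ C * (n * Real.exp (-κ * n))) ∧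
        (∃ C : ℝ, ∀ n : ℕ,
            (SBM.law α π).real
                {ω | ENNReal.ofReal t < SBM.posteriorRatioSum α π n ω.1 ω.2}
              ≤ C * (n * Real.exp (-κ * n))) := by
  classical
  have hQ : 0 < Q := by
    rcases Nat.eq_zero_or_pos Q with rfl | h
    · rw [Nat.cast_zero, div_zero] at hγQ
      exact absurd hγQ hγ.not_gt
    · exact h
  have hQ' : (1 : ℝ) ≤ Q := by exact_mod_cast hQ
  have hγ1 : γ < 1 := hγQ.trans_le ((div_le_one (by positivity)).2 hQ')
  obtain ⟨θ, hθ0, hθ⟩ := SBM.edgeParam_sum_sqrt_le_exp_neg π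
  set κ₁ : ℝ := θ * ((γ / 2) ^ 2 / (2 * Q ^ 2)) with hκ₁
  have hκ₁0 : 0 < κ₁ := by positivity
  set κ : ℝ := min κ₁ (γ / 10) with hκ
  have hκ0 : 0 < κ := lt_min hκ₁0 (by positivity)
  refine ⟨κ, hκ0, fun α hα t ht => ?_⟩
  have hαγ : ∀ q, γ ≤ (α q).toReal := fun q => (hα q).1
  set K : ℝ := (√t)⁻¹ * (Fintype.card (Equiv.Perm (Fin Q)) *
    (Q * √γ⁻¹ * Real.exp (Q * √γ⁻¹ / κ₁))) with hK
  have hK0 : 0 ≤ K := by positivity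
  -- Below `n = M` the separation bound is not available; the constant absorbs those `n`.
  set M : ℝ := 2 * Q / (γ / 2) with hM
  set C₁ : ℝ := K + Real.exp (κ * M) with hC₁
  have hgood : ∀ n : ℕ, 1 ≤ n → ∀ v : Fin n → Fin Q,
      (∀ q, γ / 2 * n ≤ (Finset.univ.filter fun i => v i = q).card) →
      (∑ y, if y ∈ SBM.errorSet α π t v then SBM.likelihood π v y else 0)
        ≤ C₁ * (n * Real.exp (-κ * n)) := by
    intro n hn v hv
    have hn' : (1 : ℝ) ≤ n := by exact_mod_cast hn
    rcases le_or_gt (2 * Q : ℝ) (γ / 2 * n) with h | h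
    · refine (SBM.sum_errorSet_likelihood_le hγ hαγ ht hA1 hQ (half_pos hγ) (by linarith) h hθ0 hθ
        hκ₁ v hv).trans ?_
      have h1 : Real.exp (-κ₁ * n) ≤ Real.exp (-κ * n) := by
        rw [Real.exp_le_exp]
        nlinarith [min_le_left κ₁ (γ / 10)]
      have h2 : K ≤ C₁ := le_add_of_nonneg_right (Real.exp_pos _).le
      gcongr
    · refine (SBM.sum_ite_likelihood_le_one π v _).trans ?_
      have hnM : (n : ℝ) ≤ M := by
        rw [hM, le_div_iff₀ (by positivity)]
        linarith
      calc (1 : ℝ) ≤ 1 * Real.exp (κ * M + -κ * n) := by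
            rw [one_mul]
            exact Real.one_le_exp (by nlinarith)
        _ ≤ n * Real.exp (κ * M + -κ * n) := by gcongr
        _ = Real.exp (κ * M) * (n * Real.exp (-κ * n)) := by rw [Real.exp_add]; ring
        _ ≤ C₁ * (n * Real.exp (-κ * n)) := by
            gcongr
            exact le_add_of_nonneg_left hK0
  refine ⟨⟨C₁, fun n₀ hn₀ zs hzs n hn => ?_⟩, C₁ + Q, fun n => ?_⟩
  · refine (SBM.edgeLaw_real_posteriorRatioSum_le α π ht zs).trans ?_
    rw [SBM.edgeLaw_real_adj_mem]
    refine hgood n (hn₀.trans hn) _ fun q => ?_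
    have hn0 : (0 : ℝ) < n := by exact_mod_cast hn₀.trans hn
    have h := hzs q n hn
    rw [le_div_iff₀ hn0] at h
    nlinarith
  · rcases Nat.eq_zero_or_pos n with rfl | hn
    · simp [SBM.posteriorRatioSum_zero]
    · have hn' : (1 : ℝ) ≤ n := by exact_mod_cast hn
      refine (SBM.law_real_posteriorRatioSum_le π hγ hαγ ht (by positivity)
        (hgood n hn)).trans ?_
      have h1 : Real.exp (-(γ / 10) * n) ≤ Real.exp (-κ * n) := by
        rw [Real.exp_le_exp]
        nlinarith [min_le_right κ₁ (γ / 10)]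
      have h2 := mul_le_mul_of_nonneg_left
        (h1.trans (le_mul_of_one_le_left (Real.exp_pos _).le hn')) (Nat.cast_nonneg (α := ℝ) Q)
      rw [add_mul]
      linarith
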